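/- Let $d \ge 3$ and let $\Gamma$ be a (finite, geometric) triangulation of a $(d-1)$-simplex $\Delta$. For a face $F$ of $\Delta$ (possibly empty or all of $\Delta$) let $\Gamma_F$ be the restriction of $\Gamma$ to $F$. Its $h$-polynomial $h(\Gamma_F;x)=\sum_i h_i x^i$ is defined by $\sum_{i=0}^{n} h_i (x+1)^{n-i} = \sum_{i=0}^{n} f_{i-1}x^{n-i}$, where $n=\dim F+1$, $f_{-1}=1$ and $f_i$ is the number of $i$-dimensional simplices of $\Gamma_F$. The local $h$-polynomial of $\Gamma$ is $$\ell(\Gamma;x)=\sum_{j=0}^{d}\ell_j x^j=\sum_{F\le\Delta}(-1)^{d-1-\dim F}\,h(\Gamma_F;x),\qquad \dim\varnothing=-1.$$ The carrier $\sigma(G)$ of a simplex $G\in\Gamma$ is the smallest face of $\Delta$ containing $G$, and the excess of $G$ is $\dim\sigma(G)-\dim G$. The internal edge graph $\Sigma(\Gamma)$ is the graph whose edges are the edges of $\Gamma$ with carrier $\Delta$ and whose vertices are the vertices incident to those edges. Suppose that $\ell_1=0$. Then each connected component $C$ of $\Sigma(\Gamma)$ contains either a vertex of excess less than $d-2$ or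 a simple $3$-cycle. Furthermore, if $d\ge 4$ and $C$ has no vertex of excess less than $d-2$, then $C$ contains at least two distinct simple $3$-cycles. -/

import Mathlib

open Polynomial

noncomputable section

/-- A (geometric) triangulation of the simplex with vertices `v i`, `i : ι`: a finite geometric
simplicial complex whose underlying space is the convex hull of the `v i`. It is meant to be used
for an affinely independent family `v`. The faces of the simplex are the convex hulls of the sets
`v '' F` for `F : Finset ι`; such a face has dimension `F.card - 1`, and `F = ∅` is the
empty face. -/
structure Triangulation {ι E : Type*} [AddCommGroup E] [Module ℝ E] (v : ι → E) extends
    Geometry.SimplicialComplex ℝ E where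
  /-- there are only finitely many simplices -/
  finite_faces : faces.Finite
  /-- the simplices cover exactly the given simplex -/
  space_eq : toSimplicialComplex.space = convexHull ℝ (Set.range v)

namespace Triangulation

variable {ι E : Type*} [Fintype ι] [AddCommGroup E] [Module ℝ E] {v : ι → E}

open Classical in
/-- The simplices (given by their vertex sets) of the restriction of `Γ` to the face `F` of the
simplex, the empty simplex included. -/
def facesIn (Γ : Triangulation v) (F : Finset ι) : Finset (Finset E) :=
  insert ∅ {s ∈ Γ.finite_faces.toFinset | (s : Set E) ⊆ convexHull ℝ (v '' F)}

/-- The number of simplices with `k` vertices (i.e. of dimension `k - 1`) in the restriction of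
`Γ` to the face `F`; this is usually denoted `f_{k-1}`. -/
def fNumber (Γ : Triangulation v) (F : Finset ι) (k : ℕ) : ℕ :=
  {s ∈ Γ.facesIn F | s.card = k}.card

/-- The `h`-polynomial of the restriction of `Γ` to the face `F`, in closed form;
`sum_coeff_hPoly` below is the usual defining identity. -/
def hPoly (Γ : Triangulation v) (F : Finset ι) : ℤ[X] :=
  ∑ k ∈ Finset.range (F.card + 1),
    (Γ.fNumber F k : ℤ[X]) * (X ^ k * (1 - X) ^ (F.card - k))

/-- The local `h`-polynomial of the restriction of `Γ` to the face `F`; for `F = Finset.univ`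
this is the local `h`-polynomial of `Γ`. See `sum_localH` below. -/
def localH (Γ : Triangulation v) (F : Finset ι) : ℤ[X] :=
  ∑ G ∈ F.powerset, (-1) ^ (F.card - G.card) * Γ.hPoly G

open Classical in
/-- The carrier of a set of points `s`: the smallest face of the simplex containing `s`,
obtained as the intersection of all faces containing `s` (see `isLeast_carrier`). -/
def carrier (_Γ : Triangulation v) (s : Finset E) : Finset ι :=
  ({F : Finset ι | (s : Set E) ⊆ convexHull ℝ (v '' F)} : Finset (Finset ι)).inf id

/-- The excess of a simplex: the dimension of its carrier minus its own dimension. -/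
def excess (Γ : Triangulation v) (s : Finset E) : ℤ :=
  (((Γ.carrier s).card : ℤ) - 1) - ((s.card : ℤ) - 1)

/-- The interior edges: the edges of `Γ` carried by the whole simplex. -/
def interiorEdges (Γ : Triangulation v) : Set (Finset E) :=
  {s ∈ Γ.faces | s.card = 2 ∧ Γ.carrier s = Finset.univ}

open Classical in
/-- The internal edge graph: its vertices are the vertices incident to interior edges,
and its edges are the interior edges. -/
def internalEdgeGraph (Γ : Triangulation v) :
    SimpleGraph {x : E // ∃ s ∈ Γ.interiorEdges, x ∈ s} where
  Adj x y := ({x.1, y.1} : Finset E) ∈ Γ.interiorEdges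
  symm := ⟨fun x y h => by rwa [Finset.pair_comm]⟩
  loopless := ⟨fun x h => by simpa using h.2.1⟩

/-! The defining identities of the notions above. -/

/-- `∑ h_i (x + 1) ^ (n - i) = ∑ f_{i-1} x ^ (n - i)` for a face with `n` vertices. -/
theorem sum_coeff_hPoly (Γ : Triangulation v) (F : Finset ι) :
    ∑ i ∈ Finset.range (F.card + 1), C ((Γ.hPoly F).coeff i) * (X + 1) ^ (F.card - i) =
      ∑ i ∈ Finset.range (F.card + 1), (Γ.fNumber F i : ℤ[X]) * X ^ (F.card - i) := by
  have key : ∀ k m : ℕ, ∑ i ∈ Finset.range (k + m + 1),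
      C (((X ^ k * (1 - X) ^ m : ℤ[X])).coeff i) * (X + 1) ^ (k + m - i) = (X ^ m : ℤ[X]) := by
    intro k m
    rw [add_assoc, Finset.sum_range_add, Finset.sum_eq_zero, zero_add]
    · have h1 : (X ^ m : ℤ[X]) = (-1 + (X + 1)) ^ m := by ring
      have h2 : ((1 - X) ^ m : ℤ[X]) = (-1) ^ m * (X + C (-1)) ^ m := by
        rw [← mul_pow]; congr 1; simp; ring
      rw [h1, add_pow]
      refine Finset.sum_congr rfl fun j hj => ?_
      have hj' : j ≤ m := by simpa [Nat.lt_succ_iff] using hj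
      have h3 : ((-1) ^ m : ℤ[X]) = C ((-1) ^ m) := by simp
      rw [coeff_X_pow_mul', if_pos (by omega), h2, h3, coeff_C_mul, coeff_X_add_C_pow,
        show k + m - (k + j) = m - j by omega, show k + j - k = j by omega]
      rw [← mul_assoc, ← pow_add, show m + (m - j) = j + 2 * (m - j) by omega, pow_add, pow_mul]
      simp
      ring
    · intro i hi
      rw [coeff_X_pow_mul', if_neg (by simpa using hi)]
      simp
  simp only [hPoly, finsetSum_coeff, map_sum, Finset.sum_mul]
  rw [Finset.sum_comm]
  refine Finset.sum_congr rfl fun k hk => ?_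
  obtain ⟨m, hm⟩ : ∃ m, F.card = k + m := ⟨F.card - k, by simp at hk; omega⟩
  rw [hm, show k + m - k = m by omega, ← key k m, Finset.mul_sum]
  refine Finset.sum_congr rfl fun i _ => ?_
  rw [← C_eq_natCast, coeff_C_mul, C_mul, mul_assoc]

/-- The `h`-polynomial is the sum of the local `h`-polynomials over all faces. -/
theorem sum_localH (Γ : Triangulation v) (F : Finset ι) :
    ∑ G ∈ F.powerset, Γ.localH G = Γ.hPoly F := by
  classical
  simp only [localH]
  rw [Finset.sum_comm' (t' := F.powerset) (s' := fun H => Finset.Icc H F)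
    (by
      intro G H
      simp only [Finset.mem_powerset, Finset.mem_Icc]
      exact ⟨fun h => ⟨⟨h.2, h.1⟩, h.2.trans h.1⟩, fun h => ⟨h.1.2, h.1.1⟩⟩)]
  have key : ∀ H ∈ F.powerset, ∑ G ∈ Finset.Icc H F, (-1 : ℤ[X]) ^ (G.card - H.card) =
      if H = F then 1 else 0 := by
    intro H hH
    rw [Finset.mem_powerset] at hH
    rw [Finset.Icc_eq_image_powerset hH, Finset.sum_image]
    · have h1 : ∀ K ∈ (F \ H).powerset,
          (-1 : ℤ[X]) ^ ((H ∪ K).card - H.card) = (((-1) ^ K.card : ℤ) : ℤ[X]) := by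
        intro K hK
        rw [Finset.mem_powerset] at hK
        rw [Finset.card_union_of_disjoint (Finset.disjoint_of_subset_right hK
          Finset.disjoint_sdiff), Nat.add_sub_cancel_left]
        simp
      rw [Finset.sum_congr rfl h1, ← Int.cast_sum, Finset.sum_powerset_neg_one_pow_card]
      have h2 : F \ H = ∅ ↔ H = F := by
        rw [Finset.sdiff_eq_empty_iff_subset]
        exact ⟨fun h => hH.antisymm h, fun h => h ▸ subset_rfl⟩
      simp only [h2]
      split_ifs <;> simp
    · intro K hK L hL h
      simp only [Finset.coe_powerset, Set.mem_preimage, Set.mem_powerset_iff,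
        Finset.coe_subset] at hK hL
      have h3 : ∀ M : Finset ι, M ⊆ F \ H → (H ∪ M) \ H = M := by
        intro M hM
        rw [Finset.union_sdiff_left]
        exact Finset.sdiff_eq_self_of_disjoint (Finset.disjoint_of_subset_left hM
          Finset.sdiff_disjoint)
      rw [← h3 K hK, ← h3 L hL]
      exact congrArg (· \ H) h
  simp only [← Finset.sum_mul]
  rw [Finset.sum_congr rfl fun H hH => by rw [key H hH]]
  simp

/-- The carrier of a set of points of the simplex is the smallest face that contains it. -/
theorem isLeast_carrier (Γ : Triangulation v) (hv : AffineIndependent ℝ v) {s : Finset E}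
    (hs : (s : Set E) ⊆ convexHull ℝ (Set.range v)) :
    IsLeast {F : Finset ι | (s : Set E) ⊆ convexHull ℝ (v '' F)} (Γ.carrier s) := by
  classical
  have hinter : ∀ F G : Finset ι, (s : Set E) ⊆ convexHull ℝ (v '' F) →
      (s : Set E) ⊆ convexHull ℝ (v '' G) →
      (s : Set E) ⊆ convexHull ℝ (v '' (F ∩ G : Finset ι)) := by
    intro F G hF hG
    have h := AffineIndependent.convexHull_inter (R := ℝ) (s := Finset.univ.image v)
      (t₁ := F.image v) (t₂ := G.image v) (hv.range.mono (by simp))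
      (Finset.image_subset_image (Finset.subset_univ F))
      (Finset.image_subset_image (Finset.subset_univ G))
    rw [Finset.coe_inter, Set.image_inter hv.injective]
    simp only [Finset.coe_image] at h
    rw [h]
    exact Set.subset_inter hF hG
  refine ⟨?_, fun F hF => Finset.inf_le (f := id) (by simpa using hF)⟩
  refine Finset.inf_induction (p := fun F : Finset ι => (s : Set E) ⊆ convexHull ℝ (v '' F))
    (by simpa using hs) (fun F hF G hG => hinter F G hF hG) (fun F hF => by simpa using hF)

end Triangulation

/-- The simple 3-cycles contained in a connected component `C` of a graph, as subgraphs. -/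
def simpleThreeCycles {V : Type*} {G : SimpleGraph V} (C : G.ConnectedComponent) :
    Set G.Subgraph :=
  {H | ∃ u ∈ C.supp, ∃ p : G.Walk u u, p.IsCycle ∧ p.length = 3 ∧ p.toSubgraph = H}

end

/-! Möbius inversion over the faces shows that `ℓ₁` counts the vertices carried by Δ when `d ≠ 1`.
So `ℓ₁ = 0` forbids interior vertices, and a vertex of excess at least `d - 2` has exactly one
vanishing barycentric coordinate: it lies in the interior of a facet. Assume this for all vertices
of `C`. Such a vertex is joined by an interior edge to every vertex off its facet with which it
shares a simplex.

First triangle (`exists_filled_triangle`): suppose no simplex contains a triangle of `C`. Take an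
edge of `C` with ends in facets `i` and `j`. In a simplex containing such an edge, every vertex off
facet `i` lies in facet `j`, and conversely. Hence the property of containing such an edge passes
between simplices that share an interior point of Δ. By connectedness it spreads along a segment to
the corner `v i`, so some simplex of this kind has a vertex in the interior of facet `j` with `i`-th
coordinate at least 1. This is absurd when there is a third coordinate.

Second triangle (`exists_mem_star_triangle`): the first one has its vertices in three distinct
facets, and for `d ≥ 4` there is a further index `l`. Moving its centroid slightly away from `v l`
scales the three coordinates by a factor above 1. The triangle alone cannot provide this, so some
simplex around it has a further vertex off one of the three facets. That vertex forms a new triangle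
with two of the old vertices. -/

open Topology

/-! ### Affine functions and barycentric coordinates -/

/-- Affine maps preserve convex combinations. -/
theorem AffineMap.map_sum_smul {ι E : Type*} [AddCommGroup E] [Module ℝ E] (f : E →ᵃ[ℝ] ℝ)
    (s : Finset ι) (w : ι → ℝ) (p : ι → E) (hw : ∑ i ∈ s, w i = 1) :
    f (∑ i ∈ s, w i • p i) = ∑ i ∈ s, w i * f (p i) := by
  have h : ∀ x, f x = f.linear x + f 0 := fun x => congrFun f.decomp x
  rw [h, map_sum]
  simp only [h (p _), map_smul, smul_eq_mul, mul_add, Finset.sum_add_distrib, ← Finset.sum_mul, hw,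
    one_mul]

theorem AffineMap.exists_ge_of_mem_convexHull {E : Type*} [AddCommGroup E] [Module ℝ E]
    (f : E →ᵃ[ℝ] ℝ) {s : Set E} {p : E} (hp : p ∈ convexHull ℝ s) : ∃ w ∈ s, f p ≤ f w := by
  by_contra! hs
  have : convexHull ℝ s ⊆ f ⁻¹' Set.Iio (f p) :=
    convexHull_min (fun w hw => hs w hw) ((convex_Iio (f p)).affine_preimage f)
  exact (show f p < f p from this hp).false

theorem AffineMap.exists_pos_of_mem_convexHull {E : Type*} [AddCommGroup E] [Module ℝ E]
    (f : E →ᵃ[ℝ] ℝ) {s : Set E} {p : E} (hp : p ∈ convexHull ℝ s) (h : 0 < f p) :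
    ∃ w ∈ s, 0 < f w :=
  (f.exists_ge_of_mem_convexHull hp).imp fun _ hw => ⟨hw.1, h.trans_le hw.2⟩

theorem AffineMap.nonneg_of_mem_convexHull {E : Type*} [AddCommGroup E] [Module ℝ E]
    (f : E →ᵃ[ℝ] ℝ) {s : Set E} {p : E} (hp : p ∈ convexHull ℝ s) (h : ∀ w ∈ s, 0 ≤ f w) :
    0 ≤ f p :=
  convexHull_min (t := f ⁻¹' Set.Ici 0) (fun w hw => h w hw) ((convex_Ici 0).affine_preimage f) hp

/-- `c` is a family of affine functions dual to the points `v`, that is, it extends the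
barycentric coordinates on the affine span of `v`. -/
def IsDualCoord {ι E : Type*} [AddCommGroup E] [Module ℝ E] (v : ι → E) (c : ι → E →ᵃ[ℝ] ℝ) :
    Prop :=
  ∀ i, c i (v i) = 1 ∧ ∀ j, j ≠ i → c i (v j) = 0

/-- Extend the points to an affine basis of the whole space, which may be infinite-dimensional, and
take its coordinates. -/
theorem AffineIndependent.exists_isDualCoord {ι E : Type*} [AddCommGroup E] [Module ℝ E]
    {v : ι → E} (hv : AffineIndependent ℝ v) : ∃ c : ι → E →ᵃ[ℝ] ℝ, IsDualCoord v c := by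
  obtain ⟨t, hst, hti, htop⟩ := exists_subset_affineIndependent_affineSpan_eq_top hv.range
  let b : AffineBasis t ℝ E := ⟨(↑), hti, by simpa using htop⟩
  refine ⟨fun i => b.coord ⟨v i, hst ⟨i, rfl⟩⟩, fun i => ⟨?_, fun j hj => ?_⟩⟩
  · exact b.coord_apply_eq ⟨v i, hst ⟨i, rfl⟩⟩
  · exact b.coord_apply_ne (i := ⟨v i, hst ⟨i, rfl⟩⟩) (j := ⟨v j, hst ⟨j, rfl⟩⟩)
      fun h => hj (hv.injective (congrArg Subtype.val h)).symm

namespace IsDualCoord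

variable {ι E : Type*} [Fintype ι] [AddCommGroup E] [Module ℝ E] {v : ι → E}
  {c : ι → E →ᵃ[ℝ] ℝ}

theorem eq_sum_smul (hc : IsDualCoord v c) {p : E} (hp : p ∈ affineSpan ℝ (Set.range v)) :
    ∑ i, c i p = 1 ∧ p = ∑ i, c i p • v i := by
  classical
  obtain ⟨w, hw, rfl⟩ := eq_affineCombination_of_mem_affineSpan_of_fintype hp
  have h : ∀ i, c i (Finset.univ.affineCombination ℝ v w) = w i := by
    intro i
    rw [Finset.affineCombination_eq_linear_combination _ _ _ hw, AffineMap.map_sum_smul _ _ _ _ hw,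
      Finset.sum_eq_single i]
    · simp [(hc i).1]
    · intro j _ hj
      simp [(hc i).2 j hj]
    · simp
  simp only [h]
  exact ⟨hw, Finset.affineCombination_eq_linear_combination _ _ _ hw⟩

omit [Fintype ι] in
theorem nonneg (hc : IsDualCoord v c) {p : E} (hp : p ∈ convexHull ℝ (Set.range v)) (i : ι) :
    0 ≤ c i p := by
  refine (c i).nonneg_of_mem_convexHull hp ?_
  rintro _ ⟨j, rfl⟩
  by_cases h : j = i
  · subst h
    simp [(hc j).1]
  · simp [(hc i).2 j h]

theorem mem_convexHull_range_iff (hc : IsDualCoord v c) {p : E} :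
    p ∈ convexHull ℝ (Set.range v) ↔
      p ∈ affineSpan ℝ (Set.range v) ∧ ∀ i, 0 ≤ c i p := by
  refine ⟨fun h => ⟨convexHull_subset_affineSpan _ h, hc.nonneg h⟩, fun ⟨h, h0⟩ => ?_⟩
  obtain ⟨h1, h2⟩ := hc.eq_sum_smul h
  rw [h2]
  exact (convex_convexHull ℝ _).sum_mem (fun i _ => h0 i) h1
    fun i _ => subset_convexHull ℝ _ ⟨i, rfl⟩

theorem mem_convexHull_image_iff (hc : IsDualCoord v c) {p : E} {F : Finset ι} :
    p ∈ convexHull ℝ (v '' F) ↔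
      p ∈ convexHull ℝ (Set.range v) ∧ ∀ i, 0 < c i p → i ∈ F := by
  classical
  refine ⟨fun h => ⟨convexHull_mono (Set.image_subset_range _ _) h, fun i hi => ?_⟩,
    fun ⟨h, h0⟩ => ?_⟩
  · obtain ⟨_, ⟨j, hj, rfl⟩, hji⟩ := (c i).exists_pos_of_mem_convexHull h hi
    by_cases hij : j = i
    · exact hij ▸ hj
    · simp [(hc i).2 j hij] at hji
  · obtain ⟨h1, h2⟩ := hc.eq_sum_smul (convexHull_subset_affineSpan _ h)
    have h3 : ∀ i ∉ F, c i p = 0 := fun i hi =>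
      le_antisymm (not_lt.1 fun hlt => hi (h0 i hlt)) (hc.nonneg h i)
    rw [← Finset.sum_subset (Finset.subset_univ F) fun i _ hi => h3 i hi] at h1
    rw [← Finset.sum_subset (Finset.subset_univ F) fun i _ hi => by simp [h3 i hi]] at h2
    rw [h2]
    exact (convex_convexHull ℝ _).sum_mem (fun i _ => hc.nonneg h i) h1
      fun i hi => subset_convexHull ℝ _ ⟨i, hi, rfl⟩

end IsDualCoord

theorem AffineMap.continuous_comp_lineMap {E : Type*} [AddCommGroup E] [Module ℝ E]
    (f : E →ᵃ[ℝ] ℝ) (p q : E) : Continuous fun t : ℝ => f (AffineMap.lineMap p q t) := by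
  simp only [AffineMap.apply_lineMap]
  simp only [AffineMap.lineMap_apply_module]
  fun_prop

/-- A line meets a simplex in a closed set. -/
theorem AffineIndependent.isClosed_setOf_lineMap_mem_convexHull {E : Type*} [AddCommGroup E]
    [Module ℝ E] {s : Finset E} (hs : AffineIndependent ℝ ((↑) : s → E)) (p q : E) :
    IsClosed {t : ℝ | AffineMap.lineMap p q t ∈ convexHull ℝ (s : Set E)} := by
  obtain ⟨c, hc⟩ := hs.exists_isDualCoord
  have hr : Set.range ((↑) : s → E) = (s : Set E) := by simp
  -- `E` carries no topology, so closedness is checked on the parameter line, where every affine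
  -- subspace is closed.
  have h : {t : ℝ | AffineMap.lineMap p q t ∈ convexHull ℝ (s : Set E)} =
      (((affineSpan ℝ (s : Set E)).comap (AffineMap.lineMap (k := ℝ) p q) :
        AffineSubspace ℝ ℝ) : Set ℝ) ∩
      ⋂ i, {t : ℝ | 0 ≤ c i (AffineMap.lineMap p q t)} := by
    ext t
    have := hc.mem_convexHull_range_iff (p := AffineMap.lineMap p q t)
    rw [hr] at this
    simpa using this
  rw [h]
  exact (AffineSubspace.closed_of_finiteDimensional _).inter (isClosed_iInter fun i =>
    isClosed_le continuous_const ((c i).continuous_comp_lineMap p q))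

/-! ### Carriers and the coefficient `ℓ₁` -/

namespace Triangulation

variable {ι E : Type*} [Fintype ι] [AddCommGroup E] [Module ℝ E] {v : ι → E}

omit [Fintype ι] in
theorem subset_convexHull_range (Γ : Triangulation v) {s : Finset E} (hs : s ∈ Γ.faces) :
    (s : Set E) ⊆ convexHull ℝ (Set.range v) :=
  Γ.space_eq ▸ Γ.toSimplicialComplex.subset_space hs

omit [Fintype ι] in
theorem exists_face_mem_convexHull (Γ : Triangulation v) {p : E}
    (hp : p ∈ convexHull ℝ (Set.range v)) : ∃ s ∈ Γ.faces, p ∈ convexHull ℝ (s : Set E) :=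
  Geometry.SimplicialComplex.mem_space_iff.1 (Γ.space_eq.symm ▸ hp)

theorem mem_carrier_iff (Γ : Triangulation v) (hv : AffineIndependent ℝ v)
    {c : ι → E →ᵃ[ℝ] ℝ} (hc : IsDualCoord v c) {s : Finset E}
    (hs : (s : Set E) ⊆ convexHull ℝ (Set.range v)) {i : ι} :
    i ∈ Γ.carrier s ↔ ∃ x ∈ s, 0 < c i x := by
  classical
  obtain ⟨h1, h2⟩ := Γ.isLeast_carrier hv hs
  constructor
  · intro hi
    have : Γ.carrier s ⊆ ({i | ∃ x ∈ s, 0 < c i x} : Finset ι) := h2 fun x hx =>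
      hc.mem_convexHull_image_iff.2 ⟨hs hx, fun i hi => by simpa using ⟨x, hx, hi⟩⟩
    simpa using this hi
  · rintro ⟨x, hx, hi⟩
    exact (hc.mem_convexHull_image_iff.1 (h1 hx)).2 i hi

theorem subset_convexHull_image_iff (Γ : Triangulation v) (hv : AffineIndependent ℝ v)
    {s : Finset E} (hs : (s : Set E) ⊆ convexHull ℝ (Set.range v)) {F : Finset ι} :
    (s : Set E) ⊆ convexHull ℝ (v '' F) ↔ Γ.carrier s ⊆ F :=
  ⟨fun h => (Γ.isLeast_carrier hv hs).2 h, fun h =>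
    (Γ.isLeast_carrier hv hs).1.trans (convexHull_mono (Set.image_mono (by exact_mod_cast h)))⟩

omit [Fintype ι] in
open Classical in
theorem fNumber_zero (Γ : Triangulation v) (F : Finset ι) : Γ.fNumber F 0 = 1 := by
  rw [fNumber, Finset.card_eq_one]
  refine ⟨∅, ?_⟩
  ext s
  simp only [facesIn, Finset.mem_filter, Finset.mem_insert, Finset.card_eq_zero,
    Finset.mem_singleton]
  tauto

open Classical in
/-- The vertices of `Γ`, as singletons. -/
noncomputable def vertexFaces (Γ : Triangulation v) : Finset (Finset E) :=
  {s ∈ Γ.finite_faces.toFinset | s.card = 1}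

open Classical in
theorem fNumber_one (Γ : Triangulation v) (hv : AffineIndependent ℝ v) (F : Finset ι) :
    Γ.fNumber F 1 = ∑ G ∈ F.powerset, {s ∈ Γ.vertexFaces | Γ.carrier s = G}.card := by
  have h : {s ∈ Γ.facesIn F | s.card = 1} = {s ∈ Γ.vertexFaces | Γ.carrier s ⊆ F} := by
    ext s
    simp only [facesIn, vertexFaces, Finset.mem_filter, Finset.mem_insert, Set.Finite.mem_toFinset]
    constructor
    · rintro ⟨rfl | ⟨h1, h2⟩, h3⟩
      · simp at h3
      · exact ⟨⟨h1, h3⟩,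
          (Γ.subset_convexHull_image_iff hv (Γ.subset_convexHull_range h1)).1 h2⟩
    · rintro ⟨⟨h1, h3⟩, h2⟩
      exact ⟨Or.inr ⟨h1,
        (Γ.subset_convexHull_image_iff hv (Γ.subset_convexHull_range h1)).2 h2⟩, h3⟩
  have h' := Finset.card_eq_sum_card_fiberwise (f := Γ.carrier)
    (s := {s ∈ Γ.vertexFaces | Γ.carrier s ⊆ F}) (t := F.powerset)
    fun s hs => by simpa using (Finset.mem_filter.1 hs).2
  rw [fNumber]
  convert h'.trans (Finset.sum_congr rfl fun G hG => ?_) using 1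
  · convert congrArg Finset.card h
  · rw [Finset.filter_filter]
    congr 1
    refine Finset.filter_congr fun s _ => ⟨fun h => h.2, ?_⟩
    rintro rfl
    exact ⟨Finset.mem_powerset.1 hG, rfl⟩

omit [Fintype ι] in
theorem coeff_one_hPoly (Γ : Triangulation v) (F : Finset ι) (hF : Γ.fNumber ∅ 1 = 0) :
    (Γ.hPoly F).coeff 1 = Γ.fNumber F 1 - F.card := by
  have h1 : ∀ n : ℕ, ((1 - X : ℤ[X]) ^ n).coeff 0 = 1 := by
    intro n
    simp [coeff_zero_eq_eval_zero]
  have h2 : ∀ n : ℕ, ((1 - X : ℤ[X]) ^ n).coeff 1 = -n := by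
    intro n
    induction n with
    | zero => simp [coeff_one]
    | succ n ih =>
      rw [pow_succ, mul_sub, mul_one, coeff_sub, coeff_mul_X, ih, h1]
      push_cast
      ring
  have h3 : ∀ k, ((Γ.fNumber F k : ℤ[X]) * (X ^ k * (1 - X) ^ (F.card - k))).coeff 1 =
      Γ.fNumber F k * if k = 0 then -(F.card : ℤ) else if k = 1 then 1 else 0 := by
    intro k
    rw [← C_eq_natCast, coeff_C_mul, coeff_X_pow_mul']
    congr 1
    rcases k with _ | _ | k
    · simp [h2]
    · simp [h1]
    · simp
  rw [hPoly, finsetSum_coeff, Finset.sum_congr rfl fun k _ => h3 k, Finset.sum_range_succ']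
  rcases Nat.eq_zero_or_pos F.card with h0 | h0
  -- For the empty face the sum has no term `k = 1`; this is where `hF` is needed.
  · rw [Finset.card_eq_zero.1 h0]
    simp [hF]
  · obtain ⟨n, hn⟩ := Nat.exists_eq_succ_of_ne_zero h0.ne'
    rw [hn, Finset.sum_range_succ']
    simp [fNumber_zero]
    ring

theorem carrier_nonempty (Γ : Triangulation v) (hv : AffineIndependent ℝ v) {s : Finset E}
    (hs : s ∈ Γ.faces) : (Γ.carrier s).Nonempty := by
  rw [Finset.nonempty_iff_ne_empty]
  intro h
  have := (Γ.isLeast_carrier hv (Γ.subset_convexHull_range hs)).1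
  obtain ⟨x, hx⟩ := Γ.nonempty_of_mem_faces hs
  rw [h] at this
  simpa using this hx

-- Summed over the subsets of `F`, both sides give `f₀ - |F|`, the linear coefficient of the
-- `h`-polynomial; induction on `F` then isolates the top term.
open Classical in
theorem coeff_one_localH (Γ : Triangulation v) (hv : AffineIndependent ℝ v) (F : Finset ι) :
    (Γ.localH F).coeff 1 =
      {s ∈ Γ.vertexFaces | Γ.carrier s = F}.card - if F.card = 1 then 1 else 0 := by
  have h0 : Γ.fNumber ∅ 1 = 0 := by
    rw [Γ.fNumber_one hv]
    simp only [Finset.powerset_empty, Finset.sum_singleton, Finset.card_eq_zero]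
    refine Finset.filter_eq_empty_iff.2 fun s hs => ?_
    have : s ∈ Γ.faces := by simpa using (Finset.mem_filter.1 hs).1
    exact (Γ.carrier_nonempty hv this).ne_empty
  induction F using Finset.strongInduction with
  | H F ih =>
    have h1 := congrArg (fun p => coeff p 1) (Γ.sum_localH F)
    simp only [finsetSum_coeff] at h1
    rw [Γ.coeff_one_hPoly F h0, Γ.fNumber_one hv] at h1
    have h2 : (F.card : ℤ) = ∑ G ∈ F.powerset, if G.card = 1 then 1 else 0 := by
      rw [Finset.sum_boole]
      have := Finset.card_powersetCard 1 F
      rw [Nat.choose_one_right, Finset.powersetCard_eq_filter] at this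
      rw [this]
    rw [h2] at h1
    push_cast at h1
    rw [← Finset.sum_sub_distrib, ← Finset.sum_erase_add _ _ (Finset.mem_powerset_self F),
      ← Finset.sum_erase_add _ _ (Finset.mem_powerset_self F)] at h1
    rw [Finset.sum_congr rfl fun G hG => ih G ?_] at h1
    · exact add_left_cancel h1
    · rw [Finset.mem_erase, Finset.mem_powerset] at hG
      exact hG.2.ssubset_of_ne hG.1

/-- If `ℓ₁ = 0` then no vertex lies in the interior of the simplex. -/
theorem carrier_singleton_ne_univ (Γ : Triangulation v) (hv : AffineIndependent ℝ v)
    (hι : Fintype.card ι ≠ 1) (hl : (Γ.localH Finset.univ).coeff 1 = 0) {x : E}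
    (hx : {x} ∈ Γ.faces) : Γ.carrier {x} ≠ Finset.univ := by
  classical
  rw [Γ.coeff_one_localH hv, Finset.card_univ, if_neg hι, sub_zero, Nat.cast_eq_zero,
    Finset.card_eq_zero, Finset.filter_eq_empty_iff] at hl
  exact hl (by simpa [vertexFaces] using hx)

end Triangulation

/-! ### Interior edges and the first triangle -/

/-- A point of a segment other than its end `q` has positive coordinate wherever the
start point has positive and the end has nonnegative coordinate. -/
theorem AffineMap.lineMap_pos {E : Type*} [AddCommGroup E] [Module ℝ E] (f : E →ᵃ[ℝ] ℝ) {p q : E}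
    (hp : 0 < f p) (hq : 0 ≤ f q) {t : ℝ} (h0 : 0 ≤ t) (h1 : t < 1) :
    0 < f (AffineMap.lineMap p q t) := by
  rw [AffineMap.apply_lineMap, AffineMap.lineMap_apply_module, smul_eq_mul, smul_eq_mul]
  have := mul_pos (sub_pos.2 h1) hp
  positivity

/-- The vertex set is recorded in order to tell two cycles apart later. -/
theorem exists_mem_simpleThreeCycles {V : Type*} {G : SimpleGraph V} {C : G.ConnectedComponent}
    {x y z : V} (hx : x ∈ C.supp) (hxy : G.Adj x y) (hyz : G.Adj y z) (hxz : G.Adj x z) :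
    ∃ H ∈ simpleThreeCycles C, H.verts = {x, y, z} := by
  let p : G.Walk x x := .cons hxy (.cons hyz (.cons hxz.symm .nil))
  refine ⟨p.toSubgraph, ⟨x, hx, p, ?_, rfl, rfl⟩, ?_⟩
  · simp [p, SimpleGraph.Walk.cons_isCycle_iff, hxy.ne, hxy.ne', hyz.ne, hxz.ne, hxz.ne']
  · ext w
    simp [p]
    tauto

namespace Triangulation

variable {ι E : Type*} [Fintype ι] [AddCommGroup E] [Module ℝ E] {v : ι → E}

/-- The vertices of the internal edge graph. -/
abbrev InternalVertex (Γ : Triangulation v) : Type _ := {x : E // ∃ s ∈ Γ.interiorEdges, x ∈ s}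

theorem InternalVertex.singleton_mem_faces {Γ : Triangulation v} (x : Γ.InternalVertex) :
    {x.1} ∈ Γ.faces := by
  obtain ⟨s, hs, hx⟩ := x.2
  exact Γ.down_closed hs.1 (by simpa using hx) (by simp)

theorem InternalVertex.mem_convexHull {Γ : Triangulation v} (x : Γ.InternalVertex) :
    x.1 ∈ convexHull ℝ (Set.range v) :=
  Γ.subset_convexHull_range x.singleton_mem_faces (by simp)

theorem InternalVertex.exists_adj {Γ : Triangulation v} (x : Γ.InternalVertex) :
    ∃ y : Γ.InternalVertex, Γ.internalEdgeGraph.Adj x y := by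
  classical
  obtain ⟨s, hs, hx⟩ := x.2
  obtain ⟨a, b, hab, rfl⟩ := Finset.card_eq_two.1 hs.2.1
  have key : ∀ y : Γ.InternalVertex, ({x.1, y.1} : Finset E) ∈ Γ.interiorEdges →
      Γ.internalEdgeGraph.Adj x y := fun y h => by
    change _ ∈ Γ.interiorEdges
    convert h
  rcases Finset.mem_insert.1 hx with h | h
  · refine ⟨⟨b, _, hs, by simp⟩, key _ ?_⟩
    rwa [h]
  · rw [Finset.mem_singleton] at h
    refine ⟨⟨a, _, hs, by simp⟩, key _ ?_⟩
    rwa [h, Finset.pair_comm]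

theorem face_of_adj {Γ : Triangulation v} {x y : Γ.InternalVertex}
    (h : Γ.internalEdgeGraph.Adj x y) : ∃ s ∈ Γ.faces, x.1 ∈ s ∧ y.1 ∈ s :=
  ⟨_, (show _ ∈ Γ.interiorEdges from h).1, by simp, by simp⟩

/-- A vertex in the interior of a facet is joined by interior edges to all vertices outside that
facet with which it shares a simplex. -/
theorem exists_adj_of_mem_face (Γ : Triangulation v) (hv : AffineIndependent ℝ v)
    {c : ι → E →ᵃ[ℝ] ℝ} (hc : IsDualCoord v c) {s : Finset E} (hs : s ∈ Γ.faces)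
    {x : Γ.InternalVertex} {i : ι} (hx0 : c i x.1 = 0) (hx : ∀ j, j ≠ i → 0 < c j x.1)
    (hxs : x.1 ∈ s) {w : E} (hws : w ∈ s) (hw : 0 < c i w) :
    ∃ y : Γ.InternalVertex, y.1 = w ∧ Γ.internalEdgeGraph.Adj x y := by
  classical
  have hne : x.1 ≠ w := by
    intro h
    rw [← h, hx0] at hw
    exact hw.false
  have hf : ({x.1, w} : Finset E) ∈ Γ.faces := by
    refine Γ.down_closed hs (fun a ha => ?_) (by simp)
    rcases Finset.mem_insert.1 ha with rfl | ha
    · exact hxs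
    · rwa [Finset.mem_singleton.1 ha]
  have he : ({x.1, w} : Finset E) ∈ Γ.interiorEdges := by
    refine ⟨hf, Finset.card_pair hne, Finset.eq_univ_of_forall fun j => ?_⟩
    rw [Γ.mem_carrier_iff hv hc (Γ.subset_convexHull_range hf)]
    by_cases hj : j = i
    · exact ⟨w, by simp, hj ▸ hw⟩
    · exact ⟨x.1, by simp, hx j hj⟩
  refine ⟨⟨w, _, he, by simp⟩, rfl, ?_⟩
  change _ ∈ Γ.interiorEdges
  convert he

/-- An interior edge lies in no facet, so its ends never share a vanishing coordinate. -/
theorem pos_of_adj {Γ : Triangulation v} (hv : AffineIndependent ℝ v)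
    {c : ι → E →ᵃ[ℝ] ℝ} (hc : IsDualCoord v c) {x y : Γ.InternalVertex}
    (h : Γ.internalEdgeGraph.Adj x y) {i : ι} (hx : c i x.1 = 0) : 0 < c i y.1 := by
  have h' : _ ∈ Γ.interiorEdges := h
  have hi : i ∈ Γ.carrier _ := h'.2.2 ▸ Finset.mem_univ i
  rw [Γ.mem_carrier_iff hv hc (Γ.subset_convexHull_range h'.1)] at hi
  obtain ⟨w, hw, hiw⟩ := hi
  simp only [Finset.mem_insert, Finset.mem_singleton] at hw
  rcases hw with rfl | rfl
  · rw [hx] at hiw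
    exact hiw.false.elim
  · exact hiw

/-- If every vertex of the component `C` of the internal edge graph lies in the interior of a facet,
then `C` contains a triangle whose vertices span a simplex. -/
theorem exists_filled_triangle (Γ : Triangulation v) (hv : AffineIndependent ℝ v)
    {c : ι → E →ᵃ[ℝ] ℝ} (hc : IsDualCoord v c) (hι : 3 ≤ Fintype.card ι)
    (C : Γ.internalEdgeGraph.ConnectedComponent)
    (hC : ∀ x ∈ C.supp, ∃ i, c i x.1 = 0 ∧ ∀ j, j ≠ i → 0 < c j x.1) :
    ∃ s ∈ Γ.faces, ∃ x ∈ C.supp, ∃ y ∈ C.supp, ∃ z ∈ C.supp,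
      (x.1 ∈ s ∧ y.1 ∈ s ∧ z.1 ∈ s) ∧ Γ.internalEdgeGraph.Adj x y ∧
        Γ.internalEdgeGraph.Adj y z ∧ Γ.internalEdgeGraph.Adj x z := by
  classical
  by_contra! hno
  have hmemC : ∀ {x y}, x ∈ C.supp → Γ.internalEdgeGraph.Adj x y → y ∈ C.supp :=
    fun hx h => C.mem_supp_of_adj_mem_supp hx h
  -- A vertex `w` off the facet of `x` is joined to `x`; were it also off the facet of `y`, then
  -- `x`, `y`, `w` would be a triangle inside `s`.
  have hsplit : ∀ s ∈ Γ.faces, ∀ x ∈ C.supp, ∀ y, x.1 ∈ s → y.1 ∈ s →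
      Γ.internalEdgeGraph.Adj x y → ∀ i, c i x.1 = 0 → ∀ w ∈ s, 0 < c i w →
      ∃ z ∈ C.supp, z.1 = w ∧ ∀ j, c j y.1 = 0 → c j z.1 = 0 := by
    intro s hs x hx y hxs hys hxy i hi w hws hw
    obtain ⟨i', hi', hix⟩ := hC x hx
    obtain rfl : i = i' := by
      by_contra hne
      exact (hix i hne).ne' hi
    obtain ⟨z, rfl, hxz⟩ := Γ.exists_adj_of_mem_face hv hc hs hi hix hxs hws hw
    have hzC := hmemC hx hxz
    refine ⟨z, hzC, rfl, fun j hj => ?_⟩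
    obtain ⟨j', hj', hjy⟩ := hC y (hmemC hx hxy)
    obtain rfl : j = j' := by
      by_contra hne
      exact (hjy j hne).ne' hj
    by_contra hjz
    obtain ⟨z', hz', hyz⟩ := Γ.exists_adj_of_mem_face hv hc hs hj hjy hys hws
      (lt_of_le_of_ne (hc.nonneg (InternalVertex.mem_convexHull z) j) (Ne.symm hjz))
    obtain rfl : z' = z := Subtype.ext hz'
    exact hno s hs x hx y (hmemC hx hxy) z' hzC ⟨hxs, hys, hws⟩ hxy hyz hxz
  obtain ⟨x, hx⟩ := C.nonempty_supp
  obtain ⟨y, hxy⟩ := InternalVertex.exists_adj x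
  obtain ⟨i, hi, hix⟩ := hC x hx
  obtain ⟨j, hj, hjy⟩ := hC y (hmemC hx hxy)
  -- the simplices containing an edge of the component whose ends lie in the facets `i` and `j`
  let P : Finset E → Prop := fun s => ∃ x ∈ C.supp, ∃ y, x.1 ∈ s ∧ y.1 ∈ s ∧
    Γ.internalEdgeGraph.Adj x y ∧ c i x.1 = 0 ∧ c j y.1 = 0
  -- The point `p` lies in the hull of `s ∩ t`, so this intersection has a vertex off facet `i` and
  -- one off facet `j`. By `hsplit` they lie in facets `j` and `i` and form the required edge in
  -- `t`.
  have hP : ∀ s ∈ Γ.faces, ∀ t ∈ Γ.faces, ∀ p, p ∈ convexHull ℝ (s : Set E) →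
      p ∈ convexHull ℝ (t : Set E) → (∀ i, 0 < c i p) → P s → P t := by
    rintro s hs t ht p hps hpt hpos ⟨x, hx, y, hxs, hys, hxy, hi, hj⟩
    have hpst := Γ.inter_subset_convexHull hs ht ⟨hps, hpt⟩
    obtain ⟨w, hw, hiw⟩ := (c i).exists_pos_of_mem_convexHull hpst (hpos i)
    obtain ⟨w', hw', hjw'⟩ := (c j).exists_pos_of_mem_convexHull hpst (hpos j)
    obtain ⟨z, hz, rfl, hz0⟩ := hsplit s hs x hx y hxs hys hxy i hi w hw.1 hiw
    obtain ⟨z', hz', rfl, hz0'⟩ :=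
      hsplit s hs y (hmemC hx hxy) x hys hxs hxy.symm j hj w' hw'.1 hjw'
    obtain ⟨k, hk, hkz⟩ := hC z hz
    obtain rfl : j = k := by
      by_contra hne
      exact (hkz j hne).ne' (hz0 j hj)
    obtain ⟨z'', hz'', hadj⟩ := Γ.exists_adj_of_mem_face hv hc hs hk hkz hw.1 hw'.1 hjw'
    obtain rfl : z'' = z' := Subtype.ext hz''
    exact ⟨z'', hz', z, hw'.2, hw.2, hadj.symm, hz0' i hi, hk⟩
  obtain ⟨s₀, hs₀, hxs₀, hys₀⟩ := face_of_adj hxy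
  have hyp := pos_of_adj hv hc hxy hi
  set p : E := AffineMap.lineMap x.1 y.1 (2⁻¹ : ℝ) with hp
  have hpseg : p ∈ segment ℝ x.1 y.1 := by
    rw [segment_eq_image_lineMap]
    exact ⟨2⁻¹, by norm_num, rfl⟩
  have hp₀ : p ∈ convexHull ℝ (s₀ : Set E) := segment_subset_convexHull hxs₀ hys₀ hpseg
  have hpΔ : p ∈ convexHull ℝ (Set.range v) :=
    (convex_convexHull ℝ _).segment_subset (InternalVertex.mem_convexHull x)
      (InternalVertex.mem_convexHull y) hpseg
  have hppos : ∀ j, 0 < c j p := by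
    intro j
    have h1 : c j p = 2⁻¹ * c j x.1 + 2⁻¹ * c j y.1 := by
      rw [hp, AffineMap.apply_lineMap, AffineMap.lineMap_apply_module]
      norm_num
    have h2 := hc.nonneg (InternalVertex.mem_convexHull y) j
    rw [h1]
    by_cases hj : j = i
    · subst hj
      rw [hi]
      linarith
    · linarith [hix j hj]
  have hvΔ : v i ∈ convexHull ℝ (Set.range v) := subset_convexHull ℝ _ ⟨i, rfl⟩
  -- From the midpoint of the edge to the corner `v i`: all coordinates stay positive before the
  -- end, so `hP` applies on `[0, 1)`, and closedness carries `P` to the corner.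
  let γ : ℝ → E := fun t => AffineMap.lineMap p (v i) t
  have hγΔ : ∀ t ∈ Set.Icc (0 : ℝ) 1, γ t ∈ convexHull ℝ (Set.range v) := fun t ht =>
    (convex_convexHull ℝ _).segment_subset hpΔ hvΔ (by
      rw [segment_eq_image_lineMap]
      exact ⟨t, ht, rfl⟩)
  have hγpos : ∀ t ∈ Set.Ico (0 : ℝ) 1, ∀ j, 0 < c j (γ t) := fun t ht j =>
    (c j).lineMap_pos (hppos j) (hc.nonneg hvΔ j) ht.1 ht.2
  have hclosed : ∀ Q : Finset E → Prop,
      IsClosed (⋃ s ∈ {s | s ∈ Γ.faces ∧ Q s}, {t : ℝ | γ t ∈ convexHull ℝ (s : Set E)}) :=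
    fun Q => (Γ.finite_faces.subset fun s hs => hs.1).isClosed_biUnion fun s hs =>
      (Γ.indep hs.1).isClosed_setOf_lineMap_mem_convexHull p (v i)
  set A := ⋃ s ∈ {s | s ∈ Γ.faces ∧ P s}, {t : ℝ | γ t ∈ convexHull ℝ (s : Set E)} with hA
  set B := ⋃ s ∈ {s | s ∈ Γ.faces ∧ ¬ P s}, {t : ℝ | γ t ∈ convexHull ℝ (s : Set E)} with hB
  have hcover : Set.Icc (0 : ℝ) 1 ⊆ A ∪ B := by
    intro t ht
    obtain ⟨s, hs, hts⟩ := Γ.exists_face_mem_convexHull (hγΔ t ht)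
    by_cases h : P s
    · exact Or.inl (Set.mem_biUnion (show s ∈ {s | s ∈ Γ.faces ∧ P s} from ⟨hs, h⟩) hts)
    · exact Or.inr (Set.mem_biUnion (show s ∈ {s | s ∈ Γ.faces ∧ ¬ P s} from ⟨hs, h⟩) hts)
  have hdisj : ¬ (Set.Ico (0 : ℝ) 1 ∩ (A ∩ B)).Nonempty := by
    rintro ⟨t, ht, htA, htB⟩
    simp only [hA, hB, Set.mem_iUnion, Set.mem_ofPred_eq, exists_prop] at htA htB
    obtain ⟨s, ⟨hs, hPs⟩, hts⟩ := htA
    obtain ⟨s', ⟨hs', hPs'⟩, hts'⟩ := htB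
    exact hPs' (hP s hs s' hs' (γ t) hts hts' (hγpos t ht) hPs)
  have h0A : (0 : ℝ) ∈ A := by
    refine Set.mem_biUnion (show s₀ ∈ {s | s ∈ Γ.faces ∧ P s} from
      ⟨hs₀, x, hx, y, hxs₀, hys₀, hxy, hi, hj⟩) ?_
    simpa [γ] using hp₀
  have hsub : Set.Ico (0 : ℝ) 1 ⊆ A := by
    intro t ht
    by_contra htA
    have htB := (hcover (Set.Ico_subset_Icc_self ht)).resolve_left htA
    exact hdisj (isPreconnected_closed_iff.1 isPreconnected_Ico A B (hclosed P)
      (hclosed fun s => ¬ P s) (Set.Ico_subset_Icc_self.trans hcover)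
      ⟨0, by simp, h0A⟩ ⟨t, ht, htB⟩)
  have h1A : (1 : ℝ) ∈ A := by
    have := (hclosed P).closure_subset_iff.2 hsub
    rw [closure_Ico zero_ne_one] at this
    exact this (by simp)
  simp only [hA, Set.mem_iUnion, Set.mem_ofPred_eq, exists_prop] at h1A
  obtain ⟨s, ⟨hs, x', hx', y', hxs', hys', hxy', hi', hj'⟩, hvs⟩ := h1A
  obtain ⟨w, hw, hiw⟩ := (c i).exists_ge_of_mem_convexHull hvs
  simp only [γ, AffineMap.lineMap_apply_one, (hc i).1] at hiw
  obtain ⟨z, hz, rfl, hz0⟩ := hsplit s hs x' hx' y' hxs' hys' hxy' i hi' w hw (by linarith)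
  obtain ⟨k, hk⟩ : ∃ k, k ∉ ({i, j} : Finset ι) := by
    by_contra! h
    have := Finset.card_le_card (fun k _ => h k : Finset.univ ⊆ ({i, j} : Finset ι))
    have := Finset.card_le_two (a := i) (b := j)
    rw [Finset.card_univ] at *
    omega
  simp only [Finset.mem_insert, Finset.mem_singleton, not_or] at hk
  obtain ⟨l, hl, hlz⟩ := hC z hz
  obtain rfl : j = l := by
    by_contra hne
    exact (hlz j hne).ne' (hz0 j hj')
  -- The coordinates of `z` sum to 1, the `i`-th is already at least 1, and the `k`-th is positive.
  have h1 := (hc.eq_sum_smul (convexHull_subset_affineSpan _ (InternalVertex.mem_convexHull z))).1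
  have h2 := Finset.sum_le_sum_of_subset_of_nonneg (Finset.subset_univ {i, k})
    fun m _ _ => hc.nonneg (InternalVertex.mem_convexHull z) m
  rw [Finset.sum_pair (Ne.symm hk.1)] at h2
  linarith [hlz k hk.2]

end Triangulation

/-! ### A second triangle -/

/-- The centroid of a simplex lies in the convex hull of no proper subset of its vertices. -/
theorem AffineIndependent.subset_of_centroid_mem_convexHull {E : Type*} [AddCommGroup E] [Module ℝ E]
    {t : Finset E} (ht : AffineIndependent ℝ ((↑) : t → E)) (hne : t.Nonempty) {u : Set E}
    (hu : u ⊆ t) (h : ∑ x ∈ t, (t.card : ℝ)⁻¹ • x ∈ convexHull ℝ u) : ↑t ⊆ u := by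
  obtain ⟨c, hc⟩ := ht.exists_isDualCoord
  intro x hx
  have hpos : (0 : ℝ) < (t.card : ℝ)⁻¹ := by
    rw [inv_pos, Nat.cast_pos]
    exact hne.card_pos
  have hval : ∀ y (hy : y ∈ t), y ≠ x → c ⟨x, hx⟩ y = 0 := fun y hy hyx =>
    (hc ⟨x, hx⟩).2 ⟨y, hy⟩ fun h => hyx (congrArg Subtype.val h)
  have hp : 0 < c ⟨x, hx⟩ (∑ x ∈ t, (t.card : ℝ)⁻¹ • x) := by
    rw [AffineMap.map_sum_smul _ _ _ (fun x => x) (by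
      rw [Finset.sum_const, nsmul_eq_mul, mul_inv_cancel₀]
      exact (inv_pos.1 hpos).ne'), Finset.sum_eq_single x]
    · have : c ⟨x, hx⟩ x = 1 := (hc ⟨x, hx⟩).1
      rw [this, mul_one]
      exact hpos
    · intro y hy hyx
      rw [hval y hy hyx, mul_zero]
    · exact fun h => absurd hx h
  obtain ⟨w, hw, hwpos⟩ := AffineMap.exists_pos_of_mem_convexHull _ h hp
  by_cases hwx : w = x
  · exact hwx ▸ hw
  · exact absurd (hval w (hu hw) hwx) hwpos.ne'

namespace Triangulation

variable {ι E : Type*} [Fintype ι] [AddCommGroup E] [Module ℝ E] {v : ι → E}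

/-- If the vertices of a triangle of `Γ` lie in the interiors of three distinct facets, and there is
a further facet, then some simplex containing the triangle has another vertex that avoids one of
the three facets. -/
theorem exists_mem_star_triangle (Γ : Triangulation v)
    {c : ι → E →ᵃ[ℝ] ℝ} (hc : IsDualCoord v c) {x y z : E} (hxy : x ≠ y) (hyz : y ≠ z)
    (hxz : x ≠ z) [DecidableEq E] (ht : {x, y, z} ∈ Γ.faces) {i j k l : ι}
    (hx : c i x = 0) (hx' : ∀ m, m ≠ i → 0 < c m x)
    (hy : c j y = 0) (hy' : ∀ m, m ≠ j → 0 < c m y)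
    (hz : c k z = 0) (hz' : ∀ m, m ≠ k → 0 < c m z)
    (hij : i ≠ j) (hjk : j ≠ k) (hik : i ≠ k) (hli : l ≠ i) (hlj : l ≠ j) (hlk : l ≠ k) :
    ∃ s ∈ Γ.faces, {x, y, z} ⊆ s ∧ ∃ w ∈ s, w ≠ x ∧ w ≠ y ∧ w ≠ z ∧
      (0 < c i w ∨ 0 < c j w ∨ 0 < c k w) := by
  by_contra! hno
  have hcard : ({x, y, z} : Finset E).card = 3 :=
    Finset.card_eq_three.2 ⟨x, y, z, hxy, hxz, hyz, rfl⟩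
  have hsum3 : ∀ {M : Type _} [AddCommMonoid M] (f : E → M),
      ∑ w ∈ {x, y, z}, f w = f x + f y + f z := by
    intro M _ f
    rw [Finset.sum_insert (by simp [hxy, hxz]), Finset.sum_pair hyz, add_assoc]
  set p : E := ∑ w ∈ {x, y, z}, ((({x, y, z} : Finset E).card : ℝ))⁻¹ • w with hp
  have hpc : ∀ m, c m p = (c m x + c m y + c m z) / 3 := by
    intro m
    rw [hp, AffineMap.map_sum_smul _ _ _ (fun x => x) (by simp [hcard]), hcard, hsum3]
    push_cast
    ring
  have hp₀ : p ∈ convexHull ℝ (({x, y, z} : Finset E) : Set E) := by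
    refine (convex_convexHull ℝ _).sum_mem (fun _ _ => by positivity) (by simp [hcard])
      fun w hw => subset_convexHull ℝ _ hw
  have hΔ := Γ.subset_convexHull_range ht
  have hpΔ : p ∈ convexHull ℝ (Set.range v) :=
    convexHull_min hΔ (convex_convexHull ℝ _) hp₀
  have hxΔ := hc.nonneg (hΔ (by simp : x ∈ _))
  have hyΔ := hc.nonneg (hΔ (by simp : y ∈ _))
  have hzΔ := hc.nonneg (hΔ (by simp : z ∈ _))
  have hpos : ∀ m, 0 < c m p := by
    intro m
    rw [hpc]
    by_cases hm : m = i
    · subst hm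
      linarith [hxΔ m, hy' m hij, hzΔ m]
    · linarith [hx' m hm, hyΔ m, hzΔ m]
  let γ : ℝ → E := fun t => AffineMap.lineMap p (v l) t
  have hγ0 : γ 0 = p := AffineMap.lineMap_apply_zero _ _
  have hev1 : ∀ᶠ t in 𝓝 (0 : ℝ), ∀ m, 0 < c m (γ t) := by
    rw [Filter.eventually_all]
    intro m
    refine continuousAt_const.eventually_lt
      ((c m).continuous_comp_lineMap p (v l)).continuousAt ?_
    simpa [γ] using hpos m
  -- A simplex containing the centroid contains the whole triangle; the finitely many others are
  -- closed along the line and miss a neighbourhood of `t = 0`.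
  have hev2 : ∀ᶠ t in 𝓝 (0 : ℝ), ∀ s ∈ Γ.faces, ¬ {x, y, z} ⊆ s →
      γ t ∉ convexHull ℝ (s : Set E) := by
    rw [Filter.eventually_all_finite Γ.finite_faces]
    intro s hs
    by_cases hts : {x, y, z} ⊆ s
    · exact Filter.Eventually.of_forall fun _ h => absurd hts h
    have hcl := (Γ.indep hs).isClosed_setOf_lineMap_mem_convexHull p (v l)
    refine (hcl.isOpen_compl.mem_nhds ?_ : _ ∈ 𝓝 (0 : ℝ)) |> Filter.mem_of_superset <|
      fun t h _ => h
    intro h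
    have hps : p ∈ convexHull ℝ (s : Set E) := by simpa using h
    have hpst := Γ.inter_subset_convexHull ht hs ⟨hp₀, hps⟩
    have := (Γ.indep ht).subset_of_centroid_mem_convexHull (by simp) Set.inter_subset_left hpst
    exact hts fun w hw => (this hw).2
  -- Negative `t` moves away from `v l`, which makes the factor `1 - t` exceed 1.
  have hev3 : ∃ᶠ t in 𝓝 (0 : ℝ), t < 0 :=
    frequently_lt_nhds 0
  obtain ⟨t, ht0, ht1, ht2⟩ := (hev3.and_eventually (hev1.and hev2)).exists
  have hγΔ : γ t ∈ convexHull ℝ (Set.range v) :=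
    hc.mem_convexHull_range_iff.2 ⟨AffineMap.lineMap_mem _
      (convexHull_subset_affineSpan _ hpΔ) (subset_affineSpan _ _ ⟨l, rfl⟩), fun m => (ht1 m).le⟩
  obtain ⟨s, hs, hts⟩ := Γ.exists_face_mem_convexHull hγΔ
  have hsub : {x, y, z} ⊆ s := by
    by_contra h
    exact ht2 s hs h hts
  obtain ⟨μ, hμ0, hμ1, hμ⟩ := Finset.mem_convexHull'.1 hts
  -- By assumption the other vertices of `s` contribute nothing to the coordinates `i`, `j`, `k`.
  have hcoord : ∀ m, (m = i ∨ m = j ∨ m = k) →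
      μ x * c m x + μ y * c m y + μ z * c m z = (1 - t) * ((c m x + c m y + c m z) / 3) := by
    intro m hm
    have h1 : c m (γ t) = (1 - t) * c m p := by
      have : c m (v l) = 0 := (hc m).2 l (by rintro rfl; tauto)
      simp only [γ]
      rw [AffineMap.apply_lineMap, AffineMap.lineMap_apply_module, this]
      simp
    rw [← hpc, ← h1, ← hμ, AffineMap.map_sum_smul _ _ _ (fun x => x) hμ1,
      ← hsum3 fun w => μ w * c m w]
    refine Finset.sum_subset hsub fun w hw hwt => ?_
    simp only [Finset.mem_insert, Finset.mem_singleton, not_or] at hwt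
    obtain ⟨h1, h2, h3⟩ := hno s hs hsub w hw hwt.1 hwt.2.1 hwt.2.2
    have h4 : c m w = 0 := by
      refine le_antisymm ?_ (hc.nonneg (Γ.subset_convexHull_range hs hw) m)
      rcases hm with rfl | rfl | rfl <;> assumption
    rw [h4, mul_zero]
  have hle : μ x + μ y + μ z ≤ 1 := by
    rw [← hμ1, ← hsum3 μ]
    exact Finset.sum_le_sum_of_subset_of_nonneg hsub fun w hw _ => hμ0 w hw
  have e1 := hcoord i (by simp)
  have e2 := hcoord j (by simp)
  have e3 := hcoord k (by simp)
  rw [hx] at e1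
  rw [hy] at e2
  rw [hz] at e3
  have key : ∀ {a b p q : ℝ}, 0 < p → 0 < q → a * p + b * q = 0 → 0 < a → b < 0 := by
    intro a b p q hp hq h ha
    by_contra! hb
    have := mul_pos ha hp
    have := mul_nonneg hb hq.le
    linarith
  have key' : ∀ {a b p q : ℝ}, 0 < p → 0 < q → a * p + b * q = 0 → a < 0 → 0 < b := by
    intro a b p q hp hq h ha
    have := key (a := -a) (b := -b) hp hq (by linarith) (by linarith)
    linarith
  -- The deviations from the scaled centroid weights have pairwise opposite signs by `f1`, `f2`,
  -- `f3`, so all vanish; but their sum is at most `t < 0`.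
  set a := μ x - (1 - t) / 3 with ha
  set b := μ y - (1 - t) / 3 with hb
  set g := μ z - (1 - t) / 3 with hg
  have f1 : b * c i y + g * c i z = 0 := by rw [hb, hg]; linarith
  have f2 : a * c j x + g * c j z = 0 := by rw [ha, hg]; linarith
  have f3 : a * c k x + b * c k y = 0 := by rw [ha, hb]; linarith
  have hneg : a + b + g < 0 := by rw [ha, hb, hg]; linarith
  rcases lt_trichotomy a 0 with ha0 | ha0 | ha0
  · have hb0 := key' (hx' k hik.symm) (hy' k hjk.symm) f3 ha0
    have hg0 := key' (hx' j hij.symm) (hz' j hjk) f2 ha0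
    exact lt_asymm hg0 (key (hy' i hij) (hz' i hik) f1 hb0)
  · rw [ha0, zero_mul, zero_add] at f2 f3
    rw [ha0, (mul_eq_zero.1 f2).resolve_right (hz' j hjk).ne',
      (mul_eq_zero.1 f3).resolve_right (hy' k hjk.symm).ne'] at hneg
    simp at hneg
  · have hb0 := key (hx' k hik.symm) (hy' k hjk.symm) f3 ha0
    have hg0 := key (hx' j hij.symm) (hz' j hjk) f2 ha0
    exact lt_asymm hg0 (key' (hy' i hij) (hz' i hik) f1 hb0)

/-- If the simplex has dimension at least three and every vertex of the component `C` of the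
internal edge graph lies in the interior of a facet, then `C` contains two distinct triangles. -/
theorem nontrivial_simpleThreeCycles (Γ : Triangulation v) (hv : AffineIndependent ℝ v)
    {c : ι → E →ᵃ[ℝ] ℝ} (hc : IsDualCoord v c) (hι : 4 ≤ Fintype.card ι)
    (C : Γ.internalEdgeGraph.ConnectedComponent)
    (hC : ∀ x ∈ C.supp, ∃ i, c i x.1 = 0 ∧ ∀ j, j ≠ i → 0 < c j x.1) :
    (simpleThreeCycles C).Nontrivial := by
  classical
  obtain ⟨s, hs, x, hx, y, hy, z, hz, ⟨hxs, hys, hzs⟩, hxy, hyz, hxz⟩ :=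
    Γ.exists_filled_triangle hv hc (by omega) C hC
  have hmemC : ∀ {x y}, x ∈ C.supp → Γ.internalEdgeGraph.Adj x y → y ∈ C.supp :=
    fun hx h => C.mem_supp_of_adj_mem_supp hx h
  have hadj : ∀ {x y : Γ.InternalVertex} {i j : ι}, c i x.1 = 0 → (∀ m, m ≠ j → 0 < c m y.1) →
      Γ.internalEdgeGraph.Adj x y → c j y.1 = 0 → i ≠ j := by
    rintro x y i j hi hj h hj0 rfl
    exact (pos_of_adj hv hc h hi).ne' hj0
  obtain ⟨i, hi, hix⟩ := hC x hx
  obtain ⟨j, hj, hjy⟩ := hC y hy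
  obtain ⟨k, hk, hkz⟩ := hC z hz
  have hij := hadj hi hjy hxy hj
  have hjk := hadj hj hkz hyz hk
  have hik := hadj hi hkz hxz hk
  obtain ⟨l, hl⟩ : ∃ l, l ∉ ({i, j, k} : Finset ι) := by
    by_contra! h
    have := Finset.card_le_card (fun k _ => h k : Finset.univ ⊆ ({i, j, k} : Finset ι))
    have := Finset.card_le_three (a := i) (b := j) (c := k)
    rw [Finset.card_univ] at *
    omega
  simp only [Finset.mem_insert, Finset.mem_singleton, not_or] at hl
  have ht : {x.1, y.1, z.1} ∈ Γ.faces := Γ.down_closed hs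
    (by simp [Finset.insert_subset_iff, hxs, hys, hzs]) (by simp)
  obtain ⟨s, hs, hts, w, hws, hwx, hwy, hwz, hw⟩ := Γ.exists_mem_star_triangle hc
    (fun h => hxy.ne (Subtype.ext h)) (fun h => hyz.ne (Subtype.ext h))
    (fun h => hxz.ne (Subtype.ext h)) ht hi hix hj hjy hk hkz hij hjk hik hl.1 hl.2.1 hl.2.2
  simp only [Finset.insert_subset_iff, Finset.singleton_subset_iff] at hts
  obtain ⟨H, hH, hHv⟩ := exists_mem_simpleThreeCycles hx hxy hyz hxz
  -- a vertex `a` of the triangle adjacent to `w` spans a triangle with `w` and one of `b`, `b'`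
  have key : ∀ (a b b' : Γ.InternalVertex) (m n n' : ι), a ∈ C.supp → b ∈ C.supp → b' ∈ C.supp →
      a.1 ∈ s → b.1 ∈ s → b'.1 ∈ s → Γ.internalEdgeGraph.Adj a b → Γ.internalEdgeGraph.Adj a b' →
      c m a.1 = 0 → (∀ o, o ≠ m → 0 < c o a.1) → c n b.1 = 0 → (∀ o, o ≠ n → 0 < c o b.1) →
      c n' b'.1 = 0 → (∀ o, o ≠ n' → 0 < c o b'.1) → n ≠ n' → 0 < c m w →
      (simpleThreeCycles C).Nontrivial := by
    intro a b b' m n n' ha hb hb' has hbs hbs' hab hab' hm hma hn hnb hn' hnb' hnn hw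
    obtain ⟨w', rfl, haw⟩ := Γ.exists_adj_of_mem_face hv hc hs hm hma has hws hw
    obtain ⟨o, ho, how⟩ := hC w' (hmemC ha haw)
    have fin : ∀ H' ∈ simpleThreeCycles C, w' ∈ H'.verts → (simpleThreeCycles C).Nontrivial := by
      refine fun H' hH' hw' => ⟨H, hH, H', hH', ?_⟩
      rintro rfl
      rw [hHv] at hw'
      rcases hw' with rfl | rfl | rfl <;> simp at hwx hwy hwz
    -- As `n ≠ n'`, the single facet of `w'` differs from that of `b` or of `b'`, so `w'` is joined
    -- to one of them.
    by_cases hon : n = o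
    · obtain ⟨u, hu, hbu⟩ := Γ.exists_adj_of_mem_face hv hc hs hn' hnb' hbs' hws
        (how n' fun h => hnn (hon.trans h.symm))
      obtain rfl : u = w' := Subtype.ext hu
      obtain ⟨H', hH', hv'⟩ := exists_mem_simpleThreeCycles ha hab' hbu haw
      exact fin H' hH' (by simp [hv'])
    · obtain ⟨u, hu, hbu⟩ := Γ.exists_adj_of_mem_face hv hc hs hn hnb hbs hws (how n hon)
      obtain rfl : u = w' := Subtype.ext hu
      obtain ⟨H', hH', hv'⟩ := exists_mem_simpleThreeCycles ha hab hbu haw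
      exact fin H' hH' (by simp [hv'])
  rcases hw with hw | hw | hw
  · exact key x y z i j k hx hy hz hts.1 hts.2.1 hts.2.2 hxy hxz hi hix hj hjy hk hkz hjk hw
  · exact key y x z j i k hy hx hz hts.2.1 hts.1 hts.2.2 hxy.symm hyz hj hjy hi hix hk hkz hik hw
  · exact key z x y k i j hz hx hy hts.2.2 hts.1 hts.2.1 hxz.symm hyz.symm hk hkz hi hix hj hjy
      hij hw

/-! ### Excess and the theorem -/

/-- If `ℓ₁ = 0`, a vertex with excess at least `d - 2` lies in the interior of a facet. -/
theorem exists_coord_eq_zero_of_excess (Γ : Triangulation v) (hv : AffineIndependent ℝ v)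
    {c : ι → E →ᵃ[ℝ] ℝ} (hc : IsDualCoord v c) (hι : Fintype.card ι ≠ 1)
    (hl : (Γ.localH Finset.univ).coeff 1 = 0) {x : E} (hx : {x} ∈ Γ.faces)
    (hex : (Fintype.card ι : ℤ) - 2 ≤ Γ.excess {x}) :
    ∃ i, c i x = 0 ∧ ∀ j, j ≠ i → 0 < c j x := by
  classical
  have hΔ := Γ.subset_convexHull_range hx
  have hmem : ∀ i, i ∈ Γ.carrier {x} ↔ 0 < c i x := fun i => by
    rw [Γ.mem_carrier_iff hv hc hΔ]
    simp
  obtain ⟨i, hi⟩ : ∃ i, i ∉ Γ.carrier {x} := by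
    by_contra! h
    exact Γ.carrier_singleton_ne_univ hv hι hl hx (Finset.eq_univ_of_forall h)
  refine ⟨i, le_antisymm (not_lt.1 ((hmem i).not.1 hi)) (hc.nonneg (hΔ (by simp)) i),
    fun j hj => ?_⟩
  by_contra hj'
  -- Two vanishing coordinates would leave a carrier with at most `d - 2` vertices, hence excess at
  -- most `d - 3`.
  have hcard := Finset.card_le_univ (insert j (insert i (Γ.carrier {x})))
  rw [Finset.card_insert_of_notMem (by simp [hj, hmem, hj']),
    Finset.card_insert_of_notMem hi] at hcard
  simp only [excess, Finset.card_singleton] at hex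
  push_cast at hex
  omega

end Triangulation

theorem mainTheorem4 {E : Type*} [AddCommGroup E] [Module ℝ E] {d : ℕ} (hd : 3 ≤ d)
    (v : Fin d → E) (hv : AffineIndependent ℝ v) (Γ : Triangulation v)
    (hl : (Γ.localH Finset.univ).coeff 1 = 0)
    (C : Γ.internalEdgeGraph.ConnectedComponent) :
    ((∃ x ∈ C.supp, Γ.excess {x.1} < (d : ℤ) - 2) ∨ (simpleThreeCycles C).Nonempty) ∧
    (4 ≤ d → (¬ ∃ x ∈ C.supp, Γ.excess {x.1} < (d : ℤ) - 2) →
      (simpleThreeCycles C).Nontrivial) := by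
  obtain ⟨c, hc⟩ := hv.exists_isDualCoord
  have hC : (¬ ∃ x ∈ C.supp, Γ.excess {x.1} < (d : ℤ) - 2) →
      ∀ x ∈ C.supp, ∃ i, c i x.1 = 0 ∧ ∀ j, j ≠ i → 0 < c j x.1 := by
    intro h x hx
    push Not at h
    exact Γ.exists_coord_eq_zero_of_excess hv hc (by rw [Fintype.card_fin]; omega) hl
      (Triangulation.InternalVertex.singleton_mem_faces x) (by simpa using h x hx)
  refine ⟨or_iff_not_imp_left.2 fun h => ?_, fun hd4 h =>
    Γ.nontrivial_simpleThreeCycles hv hc (by simpa using hd4) C (hC h)⟩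
  obtain ⟨s, -, x, hx, y, -, z, -, -, hxy, hyz, hxz⟩ :=
    Γ.exists_filled_triangle hv hc (by simpa using hd) C (hC h)
  obtain ⟨H, hH, -⟩ := exists_mem_simpleThreeCycles hx hxy hyz hxz
  exact ⟨H, hH⟩
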